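/- Let $(M,\tau)$ be a tracial von Neumann algebra (a von Neumann algebra with a faithful normal tracial state), write $\|x\|_2=\tau(x^*x)^{1/2}$, and assume that $M$ is separable, i.e. separable in the norm $\|\cdot\|_2$. For a unital von Neumann subalgebra $N\subset M$ let $E_N:M\to N$ be the unique trace-preserving conditional expectation, and for a linear map $\phi:M\to M$ put $\|\phi\|_{\infty,2}=\sup\{\|\phi(x)\|_2 : x\in M,\ \|x\|\le 1\}$. For von Neumann subalgebras $A,B\subset M$ let $$d(A,B)=\max\{\|(I-E_B)E_A\|_{\infty,2},\ \|(I-E_A)E_B\|_{\infty,2}\}.$$ A tracial von Neumann algebra $(N,\tau)$ has property (T) if for every $\varepsilon>0$ there are a finite set $F\subset N$ and $\delta>0$ such that every unital, trace-preserving, completely positive map $\phi:N\to N$ with $\max_{x\in F}\|\phi(x)-x\|_2<\delta$ satisfies $\|\phi(b)-b\|_2<\varepsilon$ for all $b\in N$ with $\|b\|\le 1$. Then the set $\mathcal T$ of all von Neumann subalgebras $N\subset M$ such that $(N,\tau|_N)$ has property (T) is separable with respect to $d$: there is a countable set $\mathcal D\subset\mathcal T$ such that for every $N\in\mathcal T$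 and every $\varepsilon>0$ there is $B\in\mathcal D$ with $d(N,B)<\varepsilon$. -/

import Mathlib

open scoped ComplexOrder CStarAlgebra

noncomputable section

namespace TracialVN

variable {H : Type*} [NormedAddCommGroup H] [InnerProductSpace ℂ H] [CompleteSpace H]

/-! ### The elements of a von Neumann algebra as an ordered C⋆-algebra -/

/-- The type of elements of a von Neumann algebra `M ⊆ B(H)`. -/
abbrev Elem (M : VonNeumannAlgebra H) : Type _ := M.toStarSubalgebra

instance isClosed_toStarSubalgebra (M : VonNeumannAlgebra H) :
    IsClosed (M.toStarSubalgebra : Set (H →L[ℂ] H)) := by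
  have h : (M.toStarSubalgebra : Set (H →L[ℂ] H)) =
      Set.centralizer (Set.centralizer (M.toStarSubalgebra : Set (H →L[ℂ] H))) :=
    M.centralizer_centralizer'.symm
  rw [h]
  exact Set.isClosed_centralizer _

/-- The elements of `M` carry the order inherited from the Loewner order of `B(H)`; this is the
usual order of the C⋆-algebra `M`. -/
instance starOrderedRing (M : VonNeumannAlgebra H) : StarOrderedRing (Elem M) := by
  refine StarOrderedRing.of_nonneg_iff' (fun {x y} hxy z => ?_) (fun x => ⟨fun hx => ?_, ?_⟩)
  · exact add_le_add_right (show (x : H →L[ℂ] H) ≤ y from hxy) (z : H →L[ℂ] H)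
  · have hx' : 0 ≤ (x : H →L[ℂ] H) := hx
    have hmem : CFC.sqrt (x : H →L[ℂ] H) ∈ M.toStarSubalgebra := by
      rw [CFC.sqrt_eq_real_sqrt _ hx']
      exact cfcₙ_mem (𝕜' := ℂ) (s := M.toStarSubalgebra) _ x.2
    refine ⟨⟨_, hmem⟩, Subtype.ext ?_⟩
    have hs : star (CFC.sqrt (x : H →L[ℂ] H)) = CFC.sqrt (x : H →L[ℂ] H) :=
      (IsSelfAdjoint.of_nonneg (CFC.sqrt_nonneg _)).star_eq
    change (x : H →L[ℂ] H) = star (CFC.sqrt (x : H →L[ℂ] H)) * CFC.sqrt (x : H →L[ℂ] H)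
    rw [hs, CFC.sqrt_mul_sqrt_self _ hx']
  · rintro ⟨s, rfl⟩
    exact star_mul_self_nonneg (s : H →L[ℂ] H)

/-! ### Tracial von Neumann algebras -/

/-- `τ` is a faithful normal tracial state on the von Neumann algebra `M`, that is, `(M, τ)` is a
tracial von Neumann algebra. Normality is continuity in the ultraweak (σ-weak) topology: the
ultraweakly continuous functionals are `x ↦ ∑ ⟪ξₙ, x ηₙ⟫` with `∑ ‖ξₙ‖² < ∞`, `∑ ‖ηₙ‖² < ∞`. -/
structure IsTrace (M : VonNeumannAlgebra H) (τ : Elem M →ₗ[ℂ] ℂ) : Prop where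
  map_one : τ 1 = 1
  nonneg : ∀ x, 0 ≤ τ (star x * x)
  trace : ∀ x y, τ (x * y) = τ (y * x)
  faithful : ∀ x, τ (star x * x) = 0 → x = 0
  normal : ∃ ξ η : ℕ → H, Summable (fun n => ‖ξ n‖ ^ 2) ∧ Summable (fun n => ‖η n‖ ^ 2) ∧
    ∀ x : Elem M, HasSum (fun n => inner ℂ (ξ n) ((x : H →L[ℂ] H) (η n))) (τ x)

/-- The norm `‖x‖₂ = τ(x⋆x)^{1/2}`. -/
def twoNorm {M : VonNeumannAlgebra H} (τ : Elem M →ₗ[ℂ] ℂ) (x : Elem M) : ℝ :=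
  √(τ (star x * x)).re

/-- `(M, τ)` is separable: `M` is separable in the norm `‖·‖₂`, i.e. the Hilbert space `L²(M, τ)`
is separable. -/
def IsSeparableTracial {M : VonNeumannAlgebra H} (τ : Elem M →ₗ[ℂ] ℂ) : Prop :=
  ∃ S : Set (Elem M), S.Countable ∧ ∀ x, ∀ ε : ℝ, 0 < ε → ∃ s ∈ S, twoNorm τ (x - s) < ε

/-- The (unital) von Neumann subalgebras of `M`. -/
abbrev Subalgebras (M : VonNeumannAlgebra H) : Type _ := {N : VonNeumannAlgebra H // N ≤ M}

/-- The inclusion of a von Neumann subalgebra. -/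
def incl {M : VonNeumannAlgebra H} (N : Subalgebras M) : Elem N.1 →⋆ₐ[ℂ] Elem M :=
  StarSubalgebra.inclusion (S₁ := N.1.toStarSubalgebra) (S₂ := M.toStarSubalgebra) N.2

/-- The restriction of the trace of `M` to a von Neumann subalgebra. -/
def restrict {M : VonNeumannAlgebra H} (τ : Elem M →ₗ[ℂ] ℂ) (N : Subalgebras M) :
    Elem N.1 →ₗ[ℂ] ℂ :=
  τ ∘ₗ (incl N).toLinearMap

/-! ### Property (T) -/

/-- Property (T) of the tracial von Neumann algebra `(N, τ)`: for every `ε > 0` there are a finite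
set `F ⊆ N` and `δ > 0` such that every unital trace-preserving completely positive map
`φ : N → N` with `‖φ(x) - x‖₂ < δ` on `F` satisfies `‖φ(b) - b‖₂ < ε` on the unit ball of `N`. -/
def HasPropertyT (N : VonNeumannAlgebra H) (τ : Elem N →ₗ[ℂ] ℂ) : Prop :=
  ∀ ε : ℝ, 0 < ε → ∃ F : Finset (Elem N), ∃ δ : ℝ, 0 < δ ∧
    ∀ φ : Elem N →CP Elem N, φ 1 = 1 → (∀ x, τ (φ x) = τ x) →
      (∀ x ∈ F, twoNorm τ (φ x - x) < δ) →
      ∀ b : Elem N, ‖b‖ ≤ 1 → twoNorm τ (φ b - b) < ε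

/-! ### Conditional expectations and the uniform distance -/

/-- `E : M → M` is a trace-preserving conditional expectation onto `N`: a positive linear map with
values in `N`, the identity on `N`, `N`-bimodular, and preserving `τ`. -/
structure IsCondExp {M : VonNeumannAlgebra H} (τ : Elem M →ₗ[ℂ] ℂ) (N : Subalgebras M)
    (E : Elem M →ₗ[ℂ] Elem M) : Prop where
  mem : ∀ x, E x ∈ Set.range (incl N)
  map_incl : ∀ b, E (incl N b) = incl N b
  map_mul_mul : ∀ b x c, E (incl N b * x * incl N c) = incl N b * E x * incl N c
  nonneg : ∀ x, 0 ≤ x → 0 ≤ E x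
  trace_eq : ∀ x, τ (E x) = τ x

/-- A trace-preserving conditional expectation onto `N` is unique. -/
theorem IsCondExp.unique {M : VonNeumannAlgebra H} {τ : Elem M →ₗ[ℂ] ℂ} (hτ : IsTrace M τ)
    {N : Subalgebras M} {E E' : Elem M →ₗ[ℂ] Elem M} (h : IsCondExp τ N E)
    (h' : IsCondExp τ N E') : E = E' := by
  have key : ∀ {E : Elem M →ₗ[ℂ] Elem M}, IsCondExp τ N E → ∀ b x,
      τ (incl N b * E x) = τ (incl N b * x) := by
    intro E h b x
    have := h.map_mul_mul b x 1
    simp only [_root_.map_one, mul_one] at this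
    rw [← this, h.trace_eq]
  ext1 x
  obtain ⟨y, hy⟩ := h.mem x
  obtain ⟨z, hz⟩ := h'.mem x
  refine sub_eq_zero.mp (hτ.faithful _ ?_)
  have hs : star (E x - E' x) = incl N (star (y - z)) := by
    rw [map_star, map_sub, hy, hz]
  rw [hs, mul_sub, map_sub, key h, key h', sub_self]

open Classical in
/-- The trace-preserving conditional expectation `E_N : M → M` onto the von Neumann subalgebra
`N`. In a tracial von Neumann algebra it exists (and is automatically normal), so that the value
`0` in the other case is never used. -/
def condExp {M : VonNeumannAlgebra H} (τ : Elem M →ₗ[ℂ] ℂ) (N : Subalgebras M) :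
    Elem M →ₗ[ℂ] Elem M :=
  if h : ∃ E, IsCondExp τ N E then h.choose else 0

/-- `‖φ‖_{∞,2} = sup {‖φ(x)‖₂ : x ∈ M, ‖x‖ ≤ 1}`. -/
def inftyTwoNorm {M : VonNeumannAlgebra H} (τ : Elem M →ₗ[ℂ] ℂ) (φ : Elem M →ₗ[ℂ] Elem M) : ℝ :=
  sSup ((fun x => twoNorm τ (φ x)) '' {x : Elem M | ‖x‖ ≤ 1})

/-- The uniform distance
`d(A, B) = max {‖(I - E_B) E_A‖_{∞,2}, ‖(I - E_A) E_B‖_{∞,2}}`. -/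
def unifDist {M : VonNeumannAlgebra H} (τ : Elem M →ₗ[ℂ] ℂ) (A B : Subalgebras M) : ℝ :=
  max (inftyTwoNorm τ ((LinearMap.id - condExp τ B) ∘ₗ condExp τ A))
    (inftyTwoNorm τ ((LinearMap.id - condExp τ A) ∘ₗ condExp τ B))

/-- The set of von Neumann subalgebras of `(M, τ)` with property (T). -/
def propertyTSubalgebras {M : VonNeumannAlgebra H} (τ : Elem M →ₗ[ℂ] ℂ) : Set (Subalgebras M) :=
  {N | HasPropertyT N.1 (restrict τ N)}

end TracialVN

end

/-!
Two subalgebras with property (T) are uniformly close as soon as Kazhdan sets of theirs are close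
in the `2`-norm. Let `F ⊆ A` be finite and `δ > 0` such that every unital trace-preserving
completely positive map on `A` that moves `F` by less than `δ` moves the unit ball by less than
`ε²`, and let `B` contain elements `δ`-close to those of `F`. The map `E_A E_B` restricted to `A`
is unital, trace-preserving and completely positive, and moves `F` by less than `δ`. Hence it moves
the unit ball of `A` by less than `ε²`, and
`‖b - E_B(b)‖₂² = τ(b⋆(b - E_A E_B(b))) ≤ ‖b - E_A E_B(b)‖₂ < ε²` for `b` in that ball
(`IsTrace.twoNorm_sub_expect_sq_le`). As `M` is `2`-norm separable, Kazhdan sets can be approximated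
by finite subsets of a fixed countable dense set; these, together with the precision and the
tolerance, form countably many data, and one algebra is chosen for each datum that occurs.

The analytic input is the existence of `E_N` as a contractive completely positive map. For
`‖x‖ ≤ 1` the functional `n ↦ τ(x n)` on `N` is dominated by `n ↦ τ(|n|)`, and such a functional is
`τ(y ·)` with `y` in the unit ball of `N` (`IsTrace.exists_density`): the unit ball of `N` is convex
and closed in `L²(N, τ)`, by weak operator compactness and normality of `τ`, so that Hahn–Banach
separation applies, and polar decomposition inside the C⋆-algebra `N`, up to `ε`, shows that the
domination leaves nothing to separate. The map `x ↦ y` is completely positive because positivity of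
a matrix over `N` is detected by the faithful trace `Tr ⊗ τ` (`IsTrace.expect_map_nonneg`).
-/

noncomputable section

namespace TracialVN

open Filter Topology

/-! ### Weak operator limits -/

section WeakLimits

variable {H : Type*} [NormedAddCommGroup H] [InnerProductSpace ℂ H] [CompleteSpace H]

/-- The unit ball of `B(H)` is compact in the weak operator topology, phrased with ultrafilters. -/
theorem exists_weak_limit {ι : Type*} (U : Ultrafilter ι) (T : ι → H →L[ℂ] H)
    (hT : ∀ i, ‖T i‖ ≤ 1) :
    ∃ S : H →L[ℂ] H, ‖S‖ ≤ 1 ∧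
      ∀ ξ η, Tendsto (fun i => inner ℂ ξ (T i η)) U (𝓝 (inner ℂ ξ (S η))) := by
  have hb : ∀ ξ η i, ‖inner ℂ ξ (T i η)‖ ≤ 1 * ‖ξ‖ * ‖η‖ := fun ξ η i => by
    calc ‖inner ℂ ξ (T i η)‖ ≤ ‖ξ‖ * ‖T i η‖ := norm_inner_le_norm _ _
      _ ≤ ‖ξ‖ * ‖η‖ := by
        gcongr
        simpa using (T i).le_of_opNorm_le (hT i) η
      _ = 1 * ‖ξ‖ * ‖η‖ := by ring
  have hex : ∀ ξ η, ∃ l : ℂ, Tendsto (fun i => inner ℂ ξ (T i η)) U (𝓝 l) ∧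
      ‖l‖ ≤ 1 * ‖ξ‖ * ‖η‖ := fun ξ η => by
    obtain ⟨l, hl, h⟩ := (isCompact_closedBall (0 : ℂ) (1 * ‖ξ‖ * ‖η‖)).ultrafilter_le_nhds'
      (U.map fun i => inner ℂ ξ (T i η)) (Filter.mem_map.2 <| Filter.univ_mem' fun i => by
        simpa using hb ξ η i)
    exact ⟨l, h, by simpa using hl⟩
  choose l hl hlb using hex
  let B : H →L⋆[ℂ] H →L[ℂ] ℂ := LinearMap.mkContinuous₂
    (LinearMap.mk₂'ₛₗ (starRingEnd ℂ) (RingHom.id ℂ) l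
      (fun ξ ξ' η => tendsto_nhds_unique (hl _ _) <| by
        simpa [inner_add_left] using (hl ξ η).add (hl ξ' η))
      (fun c ξ η => tendsto_nhds_unique (hl _ _) <| by
        simpa [inner_smul_left, mul_comm] using (hl ξ η).const_mul (starRingEnd ℂ c))
      (fun ξ η η' => tendsto_nhds_unique (hl _ _) <| by
        simpa [inner_add_right] using (hl ξ η).add (hl ξ η'))
      (fun c ξ η => tendsto_nhds_unique (hl _ _) <| by
        simpa [inner_smul_right] using (hl ξ η).const_mul c)) 1 hlb
  -- `R` represents the limit form in its first variable, hence is the adjoint of the limit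
  let R : H →L[ℂ] H := InnerProductSpace.continuousLinearMapOfBilin B
  have hR : ∀ ξ η, inner ℂ ξ (R.adjoint η) = l ξ η := fun ξ η => by
    rw [ContinuousLinearMap.adjoint_inner_right]
    exact InnerProductSpace.continuousLinearMapOfBilin_apply B ξ η
  refine ⟨R.adjoint, ?_, fun ξ η => (hR ξ η).symm ▸ hl ξ η⟩
  refine ContinuousLinearMap.opNorm_le_bound _ zero_le_one fun η => ?_
  have h := hlb (R.adjoint η) η
  rw [← hR, inner_self_eq_norm_sq_to_K, norm_pow, RCLike.norm_ofReal, abs_norm] at h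
  rcases (norm_nonneg (R.adjoint η)).eq_or_lt with h0 | h0
  · rw [← h0]; positivity
  · nlinarith

/-- A von Neumann algebra is closed under weak operator limits. -/
theorem mem_of_weak_limit {ι : Type*} {U : Ultrafilter ι} (N : VonNeumannAlgebra H)
    {T : ι → H →L[ℂ] H} (hT : ∀ i, T i ∈ N) {S : H →L[ℂ] H}
    (hS : ∀ ξ η, Tendsto (fun i => inner ℂ ξ (T i η)) U (𝓝 (inner ℂ ξ (S η)))) : S ∈ N := by
  rw [← N.commutant_commutant, VonNeumannAlgebra.mem_commutant_iff]
  intro g hg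
  rw [VonNeumannAlgebra.mem_commutant_iff] at hg
  ext1 η
  refine ext_inner_left ℂ fun ξ => tendsto_nhds_unique ?_ (hS ξ (g η))
  have h := hS (g.adjoint ξ) η
  rw [ContinuousLinearMap.adjoint_inner_left] at h
  refine h.congr fun i => ?_
  rw [ContinuousLinearMap.adjoint_inner_left]
  exact congrArg (fun A : H →L[ℂ] H => inner ℂ ξ (A η)) (hg (T i) (hT i)).symm

/-- A normal functional is weak operator continuous on the unit ball. -/
theorem IsTrace.tendsto_of_weak_limit {ι : Type*} {U : Ultrafilter ι} {N : VonNeumannAlgebra H}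
    {t : Elem N →ₗ[ℂ] ℂ} (ht : IsTrace N t) {z : ι → Elem N} (hz : ∀ i, ‖z i‖ ≤ 1) {y : Elem N}
    (hy : ∀ ξ η, Tendsto (fun i => inner ℂ ξ ((z i : H →L[ℂ] H) η)) U
      (𝓝 (inner ℂ ξ ((y : H →L[ℂ] H) η)))) (a : Elem N) :
    Tendsto (fun i => t (a * z i)) U (𝓝 (t (a * y))) := by
  obtain ⟨ξ, η, hξ, hη, hs⟩ := ht.normal
  have hsum : Summable fun n => ‖(a : H →L[ℂ] H)‖ * (‖ξ n‖ ^ 2 + ‖η n‖ ^ 2) :=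
    (hξ.add hη).mul_left _
  have key := tendsto_tsum_of_dominated_convergence (𝓕 := (U : Filter ι)) hsum
    (f := fun i n => inner ℂ (ξ n) (((a * z i : Elem N) : H →L[ℂ] H) (η n)))
    (g := fun n => inner ℂ (ξ n) (((a * y : Elem N) : H →L[ℂ] H) (η n))) (fun n => ?_)
    (Eventually.of_forall fun i n => ?_)
  · simpa only [(hs _).tsum_eq] using key
  · have h := hy ((a : H →L[ℂ] H).adjoint (ξ n)) (η n)
    simp only [ContinuousLinearMap.adjoint_inner_left] at h
    exact h
  · have h1 : ‖(a : H →L[ℂ] H) ((z i : H →L[ℂ] H) (η n))‖ ≤ ‖(a : H →L[ℂ] H)‖ * ‖η n‖ := by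
      refine (ContinuousLinearMap.le_opNorm _ _).trans ?_
      gcongr
      simpa using (z i : H →L[ℂ] H).le_of_opNorm_le (hz i) (η n)
    calc ‖inner ℂ (ξ n) ((a : H →L[ℂ] H) ((z i : H →L[ℂ] H) (η n)))‖
        ≤ ‖ξ n‖ * (‖(a : H →L[ℂ] H)‖ * ‖η n‖) := (norm_inner_le_norm _ _).trans (by gcongr)
      _ = ‖(a : H →L[ℂ] H)‖ * (‖ξ n‖ * ‖η n‖) := by ring
      _ ≤ ‖(a : H →L[ℂ] H)‖ * (‖ξ n‖ ^ 2 + ‖η n‖ ^ 2) := by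
        gcongr
        nlinarith [sq_nonneg (‖ξ n‖ - ‖η n‖), sq_nonneg (‖ξ n‖), sq_nonneg (‖η n‖)]

end WeakLimits

/-! ### Traces on C⋆-algebras -/

section CStar

variable {A : Type*} [CStarAlgebra A] [PartialOrder A] [StarOrderedRing A] {t : A →ₗ[ℂ] ℂ}

theorem map_nonneg_of_star_mul_self (hpos : ∀ x, 0 ≤ t (star x * x)) {x : A} (hx : 0 ≤ x) :
    0 ≤ t x := by
  obtain ⟨s, rfl⟩ := CStarAlgebra.nonneg_iff_eq_star_mul_self.1 hx
  exact hpos s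

theorem map_mul_nonneg (hpos : ∀ x, 0 ≤ t (star x * x)) (htr : ∀ x y, t (x * y) = t (y * x))
    {x y : A} (hx : 0 ≤ x) (hy : 0 ≤ y) : 0 ≤ t (x * y) := by
  obtain ⟨s, rfl⟩ := CStarAlgebra.nonneg_iff_eq_star_mul_self.1 hx
  rw [mul_assoc, htr]
  exact map_nonneg_of_star_mul_self hpos (star_right_conjugate_nonneg hy s)

/-- Under a faithful trace, positivity of a selfadjoint element is detected by pairing with
positive elements: pair it with its own negative part. -/
theorem nonneg_of_forall_map_mul_nonneg (hpos : ∀ x, 0 ≤ t (star x * x))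
    (hfaith : ∀ x, t (star x * x) = 0 → x = 0) {y : A} (hy : IsSelfAdjoint y)
    (h : ∀ b, 0 ≤ b → 0 ≤ t (y * b)) : 0 ≤ y := by
  rw [← CFC.negPart_eq_zero_iff y hy]
  have hn : (0 : A) ≤ y⁻ := CFC.negPart_nonneg y
  have hs : star y⁻ = y⁻ := (IsSelfAdjoint.of_nonneg hn).star_eq
  have h1 : y * y⁻ = -(star y⁻ * y⁻) := by
    have h2 : y * y⁻ = (y⁺ - y⁻) * y⁻ := by rw [CFC.posPart_sub_negPart y hy]
    rw [h2, hs, sub_mul, CFC.posPart_mul_negPart, zero_sub]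
  refine hfaith _ (le_antisymm ?_ (hpos _))
  have h2 := h _ hn
  rw [h1, map_neg] at h2
  exact neg_nonneg.1 h2

/-- A positive functional, bundled for the Gelfand–Naimark–Segal construction. -/
def toPositive (hpos : ∀ x, 0 ≤ t (star x * x)) : A →ₚ[ℂ] ℂ :=
  PositiveLinearMap.mk₀ t fun _ hx => map_nonneg_of_star_mul_self hpos hx

theorem map_star_of_pos (hpos : ∀ x, 0 ≤ t (star x * x)) (x : A) : t (star x) = star (t x) :=
  map_star (toPositive hpos) x

theorem cauchy_schwarz (hpos : ∀ x, 0 ≤ t (star x * x)) (x y : A) :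
    ‖t (star x * y)‖ ≤ √(t (star x * x)).re * √(t (star y * y)).re :=
  norm_inner_le_norm (𝕜 := ℂ) ((toPositive hpos).toPreGNS x) ((toPositive hpos).toPreGNS y)

theorem map_re_mono (hpos : ∀ x, 0 ≤ t (star x * x)) {x y : A} (h : x ≤ y) :
    (t x).re ≤ (t y).re := by
  have := map_nonneg_of_star_mul_self hpos (sub_nonneg.2 h)
  rw [map_sub, sub_nonneg] at this
  exact (Complex.le_def.1 this).1

/-- `|t(wp)| ≤ ‖w‖ t(p)` for `p ≥ 0`. -/
theorem norm_map_mul_le (hpos : ∀ x, 0 ≤ t (star x * x)) (htr : ∀ x y, t (x * y) = t (y * x))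
    (w : A) {p : A} (hp : 0 ≤ p) : ‖t (w * p)‖ ≤ ‖w‖ * (t p).re := by
  obtain ⟨s, rfl⟩ := CStarAlgebra.nonneg_iff_eq_star_mul_self.1 hp
  have h0 : 0 ≤ (t (star s * s)).re := (Complex.le_def.1 (hpos s)).1
  have h0' : t (s * star s) = t (star s * s) := htr _ _
  have h1 : (t (star (w * star s) * (w * star s))).re ≤ ‖w‖ ^ 2 * (t (star s * s)).re := by
    have h2 : star (w * star s) * (w * star s) ≤ ‖star w * w‖ • (s * star s) := by
      simpa [mul_assoc] using CStarAlgebra.star_left_conjugate_le_norm_smul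
        (a := star s) (b := star w * w) (hb := IsSelfAdjoint.star_mul_self w)
    refine (map_re_mono hpos h2).trans (le_of_eq ?_)
    rw [CStarRing.norm_star_mul_self, ← h0', ← Complex.coe_smul, map_smul, smul_eq_mul,
      Complex.re_ofReal_mul, sq]
  calc ‖t (w * (star s * s))‖ = ‖t (star (star s) * (w * star s))‖ := by
        rw [star_star, ← mul_assoc, htr]
    _ ≤ √(t (star (star s) * star s)).re * √(t (star (w * star s) * (w * star s))).re :=
        cauchy_schwarz hpos _ _
    _ ≤ √(t (star s * s)).re * (‖w‖ * √(t (star s * s)).re) := by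
        rw [star_star, h0']
        gcongr
        rw [← Real.sqrt_sq (norm_nonneg w), ← Real.sqrt_mul (sq_nonneg _)]
        exact Real.sqrt_le_sqrt h1
    _ = ‖w‖ * (t (star s * s)).re := by
        rw [mul_left_comm, Real.mul_self_sqrt h0]

/-- The functional calculus of `x ↦ (x + ε)⁻¹`, with the two scalar inequalities
`x² / (x + ε)² ≤ 1` and `x ≤ x² / (x + ε) + ε`. -/
theorem exists_regularized_inv {a : A} (ha0 : 0 ≤ a) {ε : ℝ} (hε : 0 < ε) :
    ∃ r : A, star r = r ∧ r * (a + algebraMap ℝ A ε) = 1 ∧ ‖r * (a * a) * r‖ ≤ 1 ∧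
      a ≤ a * a * r + algebraMap ℝ A ε := by
  have hsa : IsSelfAdjoint a := .of_nonneg ha0
  have hspec : ∀ x ∈ spectrum ℝ a, 0 ≤ x := fun x hx => spectrum_nonneg_of_nonneg ha0 hx
  have hne : ∀ x ∈ spectrum ℝ a, x + ε ≠ 0 := fun x hx => by linarith [hspec x hx]
  have hc : ContinuousOn (fun x : ℝ => (x + ε)⁻¹) (spectrum ℝ a) :=
    ContinuousOn.inv₀ (by fun_prop) hne
  have hc2 : ContinuousOn (fun x : ℝ => x * x) (spectrum ℝ a) := by fun_prop
  have hc3 : ContinuousOn (fun x : ℝ => (x + ε)⁻¹ * (x * x)) (spectrum ℝ a) := hc.mul hc2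
  have hc4 : ContinuousOn (fun x : ℝ => x * x * (x + ε)⁻¹) (spectrum ℝ a) := hc2.mul hc
  have hid : cfc (fun x : ℝ => x) a = a := cfc_id' ℝ a
  have haε : cfc (fun x : ℝ => x + ε) a = a + algebraMap ℝ A ε := by
    rw [cfc_add_const ε (fun x : ℝ => x) a (by fun_prop) hsa, hid]
  have haa : cfc (fun x : ℝ => x * x) a = a * a := by
    rw [cfc_mul (fun x : ℝ => x) (fun x : ℝ => x) a (by fun_prop) (by fun_prop), hid]
  have h1 : cfc (fun x : ℝ => (x + ε)⁻¹ * (x * x)) a = cfc (fun x : ℝ => (x + ε)⁻¹) a * (a * a) := by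
    rw [cfc_mul _ _ a hc hc2, haa]
  have h2 : cfc (fun x : ℝ => x * x * (x + ε)⁻¹) a = a * a * cfc (fun x : ℝ => (x + ε)⁻¹) a := by
    rw [cfc_mul _ _ a hc2 hc, haa]
  refine ⟨cfc (fun x : ℝ => (x + ε)⁻¹) a,
    (cfc_predicate (R := ℝ) _ a : IsSelfAdjoint _).star_eq, ?_, ?_, ?_⟩
  · rw [← haε, ← cfc_mul _ _ a hc (by fun_prop), cfc_congr (g := fun _ : ℝ => 1)
      (fun x hx => inv_mul_cancel₀ (hne x hx)), cfc_const_one ℝ a hsa]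
  · rw [← h1, ← cfc_mul _ _ a hc3 hc]
    refine norm_cfc_le zero_le_one fun x hx => ?_
    have hx0 := hspec x hx
    have hxε : 0 < x + ε := by linarith
    rw [Real.norm_of_nonneg (by positivity),
      show (x + ε)⁻¹ * (x * x) * (x + ε)⁻¹ = (x * x) / ((x + ε) * (x + ε)) by field_simp,
      div_le_one (by positivity)]
    nlinarith
  · rw [← h2, ← cfc_add_const ε _ a hc4 hsa]
    conv_lhs => rw [← hid]
    refine cfc_mono (fun x hx => ?_) (by fun_prop) (hc4.add continuousOn_const)
    have hx0 := hspec x hx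
    have hxε : 0 < x + ε := by linarith
    rw [← sub_nonneg, show x * x * (x + ε)⁻¹ + ε - x = ε * ε / (x + ε) by field_simp; ring]
    positivity

/-- An approximate polar decomposition that stays inside the C⋆-algebra: `z = n(|n| + ε)⁻¹`. -/
theorem exists_approx_polar (n : A) {ε : ℝ} (hε : 0 < ε) :
    ∃ z : A, ‖z‖ ≤ 1 ∧ n = z * (CFC.abs n + algebraMap ℝ A ε) ∧
      CFC.abs n ≤ star n * z + algebraMap ℝ A ε := by
  obtain ⟨r, hrs, hr, hrn, hra⟩ := exists_regularized_inv (CFC.abs_nonneg n) hε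
  rw [CFC.abs_mul_abs] at hrn hra
  refine ⟨n * r, ?_, by rw [mul_assoc, hr, mul_one], by rwa [← mul_assoc]⟩
  have h2 : ‖n * r‖ * ‖n * r‖ ≤ 1 := by
    rw [← CStarRing.norm_star_mul_self, star_mul, hrs]
    simpa only [mul_assoc] using hrn
  nlinarith [norm_nonneg (n * r)]

end CStar

/-! ### A Radon–Nikodym theorem for traces -/

section RadonNikodym

variable {H : Type*} [NormedAddCommGroup H] [InnerProductSpace ℂ H] [CompleteSpace H]
  {N : VonNeumannAlgebra H} {t : Elem N →ₗ[ℂ] ℂ}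

/-- The Hilbert space `L²(N, t)`. -/
abbrev IsTrace.L2 (ht : IsTrace N t) : Type _ := (toPositive ht.nonneg).GNS

/-- The canonical map `N → L²(N, t)`. -/
def IsTrace.toL2 (ht : IsTrace N t) (x : Elem N) : ht.L2 :=
  (((toPositive ht.nonneg).toPreGNS x : (toPositive ht.nonneg).PreGNS) : ht.L2)

theorem IsTrace.inner_toL2 (ht : IsTrace N t) (x y : Elem N) :
    inner ℂ (ht.toL2 x) (ht.toL2 y) = t (star x * y) :=
  UniformSpace.Completion.inner_coe _ _

theorem IsTrace.norm_toL2 (ht : IsTrace N t) (x : Elem N) : ‖ht.toL2 x‖ = twoNorm t x :=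
  UniformSpace.Completion.norm_coe _

theorem IsTrace.twoNorm_le_norm (ht : IsTrace N t) (x : Elem N) : twoNorm t x ≤ ‖x‖ := by
  have h := norm_map_mul_le ht.nonneg ht.trace (star x * x) (p := 1) zero_le_one
  rw [mul_one, ht.map_one, Complex.one_re, mul_one, CStarRing.norm_star_mul_self] at h
  exact Real.sqrt_le_iff.2 ⟨norm_nonneg x, (Complex.re_le_norm _).trans (h.trans_eq (sq _).symm)⟩

/-- The unit ball of `N` is closed in `L²(N, t)`: an `L²`-limit of elements of the ball is one of
their weak operator limits. This is where normality of the trace enters. -/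
theorem IsTrace.isClosed_toL2_ball (ht : IsTrace N t) :
    IsClosed (ht.toL2 '' {z | ‖z‖ ≤ 1}) := by
  refine IsSeqClosed.isClosed fun v w hv hw => ?_
  choose z hz hzv using hv
  let U : Ultrafilter ℕ := hyperfilter ℕ
  obtain ⟨S, hS1, hS⟩ := exists_weak_limit U (fun k => (z k : H →L[ℂ] H)) hz
  let y : Elem N := ⟨S, mem_of_weak_limit N (fun k => (z k).2) hS⟩
  refine ⟨y, hS1, ext_inner_left ℂ fun u => ?_⟩
  induction u using UniformSpace.Completion.induction_on with
  | hp => exact isClosed_eq (by fun_prop) (by fun_prop)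
  | ih a' =>
    obtain ⟨a, rfl⟩ := (toPositive ht.nonneg).toPreGNS.surjective a'
    change inner ℂ (ht.toL2 a) (ht.toL2 y) = inner ℂ (ht.toL2 a) w
    have h1 : Tendsto (fun k => inner ℂ (ht.toL2 a) (v k)) U (𝓝 (inner ℂ (ht.toL2 a) w)) :=
      ((continuous_const.inner continuous_id).tendsto w).comp (hw.mono_left Nat.hyperfilter_le_atTop)
    refine tendsto_nhds_unique ?_ h1
    rw [ht.inner_toL2]
    refine (ht.tendsto_of_weak_limit (y := y) hz hS (star a)).congr fun k => ?_
    rw [← hzv, ht.inner_toL2]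

theorem IsTrace.convex_toL2_ball (ht : IsTrace N t) :
    Convex ℝ (ht.toL2 '' {z | ‖z‖ ≤ 1}) := by
  rintro _ ⟨x, hx, rfl⟩ _ ⟨y, hy, rfl⟩ a b ha hb hab
  refine ⟨(a : ℂ) • x + (b : ℂ) • y, ?_, ?_⟩
  · calc ‖(a : ℂ) • x + (b : ℂ) • y‖ ≤ ‖(a : ℂ) • x‖ + ‖(b : ℂ) • y‖ := norm_add_le _ _
      _ = a * ‖x‖ + b * ‖y‖ := by
        rw [norm_smul, norm_smul, Complex.norm_of_nonneg ha, Complex.norm_of_nonneg hb]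
      _ ≤ a * 1 + b * 1 := by gcongr <;> assumption
      _ = 1 := by rw [mul_one, mul_one, hab]
  · rw [← Complex.coe_smul a (ht.toL2 x), ← Complex.coe_smul b (ht.toL2 y)]
    simp only [IsTrace.toL2, map_add, map_smul, UniformSpace.Completion.coe_add,
      UniformSpace.Completion.coe_smul]

/-- A functional on `N` dominated by `n ↦ t(|n|)` is `t(y ·)` for some `y` in the unit ball of `N`.
It is represented by a vector of `L²(N, t)`; a functional separating that vector from the unit ball
would be close to some `n ∈ N`, and an approximate polar part of `n` contradicts the
domination. -/
theorem IsTrace.exists_density (ht : IsTrace N t) (f : Elem N →ₗ[ℂ] ℂ)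
    (hf : ∀ n, ‖f n‖ ≤ (t (CFC.abs n)).re) : ∃ y : Elem N, ‖y‖ ≤ 1 ∧ ∀ n, f n = t (y * n) := by
  have hf2 : ∀ n, ‖f n‖ ≤ 1 * ‖(toPositive ht.nonneg).toPreGNS n‖ := fun n => by
    have h := cauchy_schwarz ht.nonneg 1 (CFC.abs n)
    rw [star_one, one_mul, one_mul, ht.map_one, Complex.one_re, Real.sqrt_one,
      (IsSelfAdjoint.of_nonneg (CFC.abs_nonneg n)).star_eq, CFC.abs_mul_abs] at h
    exact (hf n).trans ((Complex.re_le_norm _).trans h)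
  let f₁ : (toPositive ht.nonneg).PreGNS →L[ℂ] ℂ :=
    (f ∘ₗ (toPositive ht.nonneg).ofPreGNS.toLinearMap).mkContinuous 1 hf2
  let f₂ : ht.L2 →L[ℂ] ℂ := f₁.extend UniformSpace.Completion.toComplL
  have hf₂ : ∀ n, f₂ (ht.toL2 n) = f n := fun n =>
    ContinuousLinearMap.extend_eq f₁ UniformSpace.Completion.denseRange_coe
      (UniformSpace.Completion.isUniformInducing_coe _) _
  let ξ : ht.L2 := (InnerProductSpace.toDual ℂ ht.L2).symm f₂
  have hξ : ∀ n, inner ℂ ξ (ht.toL2 n) = f n := fun n => by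
    rw [InnerProductSpace.toDual_symm_apply, hf₂]
  have hmem : ξ ∈ ht.toL2 '' {z | ‖z‖ ≤ 1} := by
    by_contra hnot
    obtain ⟨g, u, hg, hu⟩ := RCLike.geometric_hahn_banach_closed_point (𝕜 := ℂ)
      ht.convex_toL2_ball ht.isClosed_toL2_ball hnot
    let η : ht.L2 := (InnerProductSpace.toDual ℂ ht.L2).symm g
    have hη : ∀ v, g v = inner ℂ η v := fun v => InnerProductSpace.toDual_symm_apply.symm
    set δ : ℝ := (RCLike.re (g ξ) - u) / (2 + ‖ξ‖) with hδ
    have hξ0 := norm_nonneg ξ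
    have hδ0 : 0 < δ := div_pos (sub_pos.2 hu) (by positivity)
    have hδ' : δ * (2 + ‖ξ‖) = RCLike.re (g ξ) - u := div_mul_cancel₀ _ (by positivity)
    obtain ⟨n, hn⟩ : ∃ n, ‖η - ht.toL2 n‖ < δ := by
      obtain ⟨n, hn⟩ := (UniformSpace.Completion.denseRange_coe
        (α := (toPositive ht.nonneg).PreGNS)).exists_dist_lt η hδ0
      exact ⟨n, by rwa [dist_eq_norm] at hn⟩
    have hclose : ∀ v : ht.L2, |RCLike.re (g v) - RCLike.re (inner ℂ (ht.toL2 n) v)| ≤ δ * ‖v‖ :=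
      fun v => by
      rw [hη, ← map_sub, ← inner_sub_left]
      exact (RCLike.abs_re_le_norm _).trans ((norm_inner_le_norm _ _).trans (by gcongr))
    obtain ⟨z, hz, -, hz'⟩ := exists_approx_polar n hδ0
    have h1 : (t (CFC.abs n)).re ≤ RCLike.re (inner ℂ (ht.toL2 n) (ht.toL2 z)) + δ := by
      have h := map_re_mono ht.nonneg hz'
      rw [map_add, Algebra.algebraMap_eq_smul_one, ← Complex.coe_smul, map_smul, ht.map_one] at h
      rw [ht.inner_toL2]
      simpa using h
    have h2 : RCLike.re (inner ℂ (ht.toL2 n) ξ) ≤ (t (CFC.abs n)).re := by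
      refine le_trans (RCLike.re_le_norm _) ?_
      rw [norm_inner_symm, hξ]
      exact hf n
    have h3 := abs_le.1 (hclose ξ)
    have h4 := abs_le.1 (hclose (ht.toL2 z))
    have h5 : ‖ht.toL2 z‖ ≤ 1 := (ht.norm_toL2 z).trans_le ((ht.twoNorm_le_norm z).trans hz)
    have h6 := hg _ ⟨z, hz, rfl⟩
    nlinarith
  obtain ⟨z, hz, hzξ⟩ := hmem
  refine ⟨star z, by rwa [norm_star], fun n => ?_⟩
  rw [← hξ, ← hzξ, ht.inner_toL2]

end RadonNikodym

/-! ### Matrix amplification of a trace -/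

section Matrix

variable {A : Type*} [CStarAlgebra A] {t : A →ₗ[ℂ] ℂ} {k : ℕ}

/-- The unnormalized trace `Tr ⊗ t` on `M_k(A)`. -/
def matrixTrace (t : A →ₗ[ℂ] ℂ) (k : ℕ) : CStarMatrix (Fin k) (Fin k) A →ₗ[ℂ] ℂ where
  toFun X := ∑ i, t (X i i)
  map_add' X Y := by simp [Finset.sum_add_distrib]
  map_smul' c X := by simp [Finset.mul_sum]

theorem matrixTrace_mul (X Y : CStarMatrix (Fin k) (Fin k) A) :
    matrixTrace t k (X * Y) = ∑ i, ∑ j, t (X i j * Y j i) := by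
  simp [matrixTrace, CStarMatrix.mul_apply]

theorem matrixTrace_star_mul_self (X : CStarMatrix (Fin k) (Fin k) A) :
    matrixTrace t k (star X * X) = ∑ i, ∑ j, t (star (X j i) * X j i) := by
  simp [matrixTrace_mul, CStarMatrix.star_apply]

theorem matrixTrace_nonneg (hpos : ∀ x, 0 ≤ t (star x * x)) (X : CStarMatrix (Fin k) (Fin k) A) :
    0 ≤ matrixTrace t k (star X * X) := by
  rw [matrixTrace_star_mul_self]
  exact Finset.sum_nonneg fun i _ => Finset.sum_nonneg fun j _ => hpos _

theorem matrixTrace_trace (htr : ∀ x y, t (x * y) = t (y * x))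
    (X Y : CStarMatrix (Fin k) (Fin k) A) :
    matrixTrace t k (X * Y) = matrixTrace t k (Y * X) := by
  rw [matrixTrace_mul, matrixTrace_mul, Finset.sum_comm]
  simp_rw [htr]

theorem matrixTrace_faithful (hpos : ∀ x, 0 ≤ t (star x * x))
    (hfaith : ∀ x, t (star x * x) = 0 → x = 0) (X : CStarMatrix (Fin k) (Fin k) A)
    (hX : matrixTrace t k (star X * X) = 0) : X = 0 := by
  rw [matrixTrace_star_mul_self,
    Finset.sum_eq_zero_iff_of_nonneg fun i _ => Finset.sum_nonneg fun j _ => hpos _] at hX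
  ext i j
  have h := (Finset.sum_eq_zero_iff_of_nonneg fun j _ => hpos _).1 (hX j (Finset.mem_univ j)) i
    (Finset.mem_univ i)
  exact hfaith _ h

end Matrix

variable {H : Type*} [NormedAddCommGroup H] [InnerProductSpace ℂ H] [CompleteSpace H]
  {M : VonNeumannAlgebra H} {τ : Elem M →ₗ[ℂ] ℂ}

/-! ### The `2`-norm -/

theorem IsTrace.twoNorm_sq (hτ : IsTrace M τ) (x : Elem M) : twoNorm τ x ^ 2 = (τ (star x * x)).re :=
  Real.sq_sqrt (Complex.le_def.1 (hτ.nonneg x)).1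

theorem twoNorm_nonneg (x : Elem M) : 0 ≤ twoNorm τ x := Real.sqrt_nonneg _

theorem IsTrace.twoNorm_add_le (hτ : IsTrace M τ) (x y : Elem M) :
    twoNorm τ (x + y) ≤ twoNorm τ x + twoNorm τ y :=
  norm_add_le ((toPositive hτ.nonneg).toPreGNS x) ((toPositive hτ.nonneg).toPreGNS y)

theorem twoNorm_sub_comm (x y : Elem M) : twoNorm τ (x - y) = twoNorm τ (y - x) := by
  rw [twoNorm, twoNorm, ← neg_sub y x, star_neg, neg_mul_neg]

theorem IsTrace.twoNorm_sub_le (hτ : IsTrace M τ) (x y z : Elem M) :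
    twoNorm τ (x - z) ≤ twoNorm τ (x - y) + twoNorm τ (y - z) := by
  simpa using hτ.twoNorm_add_le (x - y) (y - z)

/-! ### The conditional expectation -/

theorem twoNorm_incl (N : Subalgebras M) (n : Elem N.1) :
    twoNorm τ (incl N n) = twoNorm (restrict τ N) n := by
  simp [twoNorm, restrict, ← map_star]

theorem IsTrace.subalgebra (hτ : IsTrace M τ) (N : Subalgebras M) : IsTrace N.1 (restrict τ N) where
  map_one := by simp [restrict, hτ.map_one]
  nonneg x := by simpa [restrict, ← map_star] using hτ.nonneg (incl N x)
  trace x y := by simpa [restrict] using hτ.trace (incl N x) (incl N y)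
  faithful x hx := by
    have h := hτ.faithful (incl N x) (by simpa [restrict, ← map_star] using hx)
    exact Subtype.ext (congrArg (fun z : Elem M => (z : H →L[ℂ] H)) h)
  normal := by
    obtain ⟨ξ, η, hξ, hη, h⟩ := hτ.normal
    exact ⟨ξ, η, hξ, hη, fun x => h (incl N x)⟩

theorem IsTrace.eq_of_map_mul_eq (hτ : IsTrace M τ) {x y : Elem M}
    (h : ∀ b, τ (x * b) = τ (y * b)) : x = y := by
  refine sub_eq_zero.1 (hτ.faithful _ ?_)
  rw [hτ.trace, sub_mul, map_sub, h, sub_self]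

/-- The domination that makes `IsTrace.exists_density` applicable to `n ↦ τ(x n)`: with
`n = z(|n| + ε)` one has `|τ(x n)| ≤ ‖x z‖ τ(|n| + ε)`. -/
theorem IsTrace.norm_map_mul_incl_le (hτ : IsTrace M τ) (N : Subalgebras M) {x : Elem M}
    (hx : ‖x‖ ≤ 1) (n : Elem N.1) :
    ‖τ (x * incl N n)‖ ≤ (restrict τ N (CFC.abs n)).re := by
  refine le_of_forall_pos_le_add fun ε hε => ?_
  obtain ⟨z, hz, hn, -⟩ := exists_approx_polar n hε
  set p := CFC.abs n + algebraMap ℝ (Elem N.1) ε with hp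
  have hp0 : 0 ≤ incl N p :=
    map_nonneg (incl N) (add_nonneg (CFC.abs_nonneg n) (algebraMap_nonneg _ hε.le))
  have hpt : (τ (incl N p)).re = (restrict τ N (CFC.abs n)).re + ε := by
    change (restrict τ N p).re = _
    rw [hp, map_add, Algebra.algebraMap_eq_smul_one, ← Complex.coe_smul, map_smul,
      (hτ.subalgebra N).map_one]
    simp
  have hxz : ‖x * incl N z‖ ≤ 1 :=
    (norm_mul_le _ _).trans (mul_le_one₀ hx (norm_nonneg _) hz)
  have hp1 : 0 ≤ (τ (incl N p)).re :=
    (Complex.le_def.1 (map_nonneg_of_star_mul_self hτ.nonneg hp0)).1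
  have hxn : x * incl N n = x * incl N z * incl N p := by rw [mul_assoc, ← map_mul, ← hn]
  rw [hxn, ← hpt]
  exact (norm_map_mul_le hτ.nonneg hτ.trace _ hp0).trans (mul_le_of_le_one_left hp1 hxz)

theorem IsTrace.exists_expect_apply (hτ : IsTrace M τ) (N : Subalgebras M) (x : Elem M) :
    ∃ y : Elem N.1, ‖y‖ ≤ ‖x‖ ∧ ∀ n, restrict τ N (y * n) = τ (x * incl N n) := by
  rcases eq_or_ne x 0 with rfl | hx
  · exact ⟨0, by simp, by simp⟩
  have hx0 : ‖x‖ ≠ 0 := norm_ne_zero_iff.2 hx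
  have hxc : (‖x‖ : ℂ) ≠ 0 := Complex.ofReal_ne_zero.2 hx0
  have h1 : ‖(‖x‖ : ℂ)⁻¹ • x‖ ≤ 1 := by
    rw [norm_smul, norm_inv, Complex.norm_of_nonneg (norm_nonneg x), inv_mul_cancel₀ hx0]
  obtain ⟨y, hy, h⟩ := (hτ.subalgebra N).exists_density
    (τ ∘ₗ LinearMap.mulLeft ℂ ((‖x‖ : ℂ)⁻¹ • x) ∘ₗ (incl N).toLinearMap)
    (hτ.norm_map_mul_incl_le N h1)
  refine ⟨(‖x‖ : ℂ) • y, ?_, fun n => ?_⟩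
  · rw [norm_smul, Complex.norm_of_nonneg (norm_nonneg x)]
    exact mul_le_of_le_one_right (norm_nonneg x) hy
  · rw [smul_mul_assoc, map_smul, ← h n]
    change (‖x‖ : ℂ) • τ (((‖x‖ : ℂ)⁻¹ • x) * incl N n) = _
    rw [← map_smul, smul_mul_assoc, smul_inv_smul₀ hxc]

/-- The value of the trace-preserving conditional expectation at `x`, as an element of `N`. -/
def IsTrace.expectFun (hτ : IsTrace M τ) (N : Subalgebras M) (x : Elem M) : Elem N.1 :=
  (hτ.exists_expect_apply N x).choose

theorem IsTrace.restrict_expectFun_mul (hτ : IsTrace M τ) (N : Subalgebras M) (x : Elem M)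
    (n : Elem N.1) : restrict τ N (hτ.expectFun N x * n) = τ (x * incl N n) :=
  (hτ.exists_expect_apply N x).choose_spec.2 n

/-- The trace-preserving conditional expectation, as a map `M → N`. -/
def IsTrace.expect (hτ : IsTrace M τ) (N : Subalgebras M) : Elem M →ₗ[ℂ] Elem N.1 where
  toFun := hτ.expectFun N
  map_add' x y := (hτ.subalgebra N).eq_of_map_mul_eq fun n => by
    simp only [add_mul, map_add, hτ.restrict_expectFun_mul]
  map_smul' c x := (hτ.subalgebra N).eq_of_map_mul_eq fun n => by
    simp only [smul_mul_assoc, map_smul, hτ.restrict_expectFun_mul, RingHom.id_apply]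

section Expect

variable (hτ : IsTrace M τ) (N : Subalgebras M)

theorem IsTrace.norm_expect_le (x : Elem M) : ‖hτ.expect N x‖ ≤ ‖x‖ :=
  (hτ.exists_expect_apply N x).choose_spec.1

theorem IsTrace.restrict_expect_mul (x : Elem M) (n : Elem N.1) :
    restrict τ N (hτ.expect N x * n) = τ (x * incl N n) :=
  hτ.restrict_expectFun_mul N x n

theorem IsTrace.map_incl_expect_mul (x : Elem M) (n : Elem N.1) :
    τ (incl N (hτ.expect N x) * incl N n) = τ (x * incl N n) := by
  rw [← map_mul]
  exact hτ.restrict_expect_mul N x n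

theorem IsTrace.expect_incl (n : Elem N.1) : hτ.expect N (incl N n) = n :=
  (hτ.subalgebra N).eq_of_map_mul_eq fun b => by
    rw [hτ.restrict_expect_mul, ← map_mul]
    rfl

theorem IsTrace.restrict_expect (x : Elem M) : restrict τ N (hτ.expect N x) = τ x := by
  simpa using hτ.restrict_expect_mul N x 1

theorem IsTrace.expect_mul_mul (b : Elem N.1) (x : Elem M) (c : Elem N.1) :
    hτ.expect N (incl N b * x * incl N c) = b * hτ.expect N x * c :=
  (hτ.subalgebra N).eq_of_map_mul_eq fun n => by
    have h1 : b * hτ.expect N x * c * n = b * (hτ.expect N x * (c * n)) := by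
      simp only [mul_assoc]
    have h2 : incl N b * x * incl N c * incl N n = incl N b * (x * (incl N c * incl N n)) := by
      simp only [mul_assoc]
    rw [hτ.restrict_expect_mul, h1, h2, (hτ.subalgebra N).trace, hτ.trace, mul_assoc x,
      mul_assoc (hτ.expect N x), hτ.restrict_expect_mul, map_mul (incl N), map_mul (incl N)]

theorem IsTrace.expect_star (x : Elem M) : hτ.expect N (star x) = star (hτ.expect N x) :=
  (hτ.subalgebra N).eq_of_map_mul_eq fun n => by
    rw [hτ.restrict_expect_mul, (hτ.subalgebra N).trace]
    have h1 : star x * incl N n = star (incl N (star n) * x) := by simp [map_star]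
    have h2 : n * star (hτ.expect N x) = star (hτ.expect N x * star n) := by simp
    rw [h1, h2, map_star_of_pos hτ.nonneg, map_star_of_pos (hτ.subalgebra N).nonneg,
      hτ.restrict_expect_mul, hτ.trace]

/-- Complete positivity of the conditional expectation: its amplification is the trace-preserving
expectation for `Tr ⊗ τ`, so positivity can be tested against positive matrices over `N`. -/
theorem IsTrace.expect_map_nonneg (k : ℕ) (X : CStarMatrix (Fin k) (Fin k) (Elem M))
    (hX : 0 ≤ X) : 0 ≤ X.map (hτ.expect N) := by
  have ht := hτ.subalgebra N
  have hsa : IsSelfAdjoint (X.map (hτ.expect N)) := by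
    have h := (IsSelfAdjoint.of_nonneg hX).star_eq
    ext i j
    rw [CStarMatrix.star_apply, CStarMatrix.map_apply, CStarMatrix.map_apply, ← hτ.expect_star,
      ← CStarMatrix.star_apply, h]
  refine nonneg_of_forall_map_mul_nonneg (t := matrixTrace (restrict τ N) k)
    (matrixTrace_nonneg ht.nonneg) (matrixTrace_faithful ht.nonneg ht.faithful) hsa fun B hB => ?_
  have hB' : 0 ≤ B.map (incl N) :=
    CompletelyPositiveMapClass.map_cstarMatrix_nonneg' (incl N) k B hB
  have h : matrixTrace (restrict τ N) k (X.map (hτ.expect N) * B) =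
      matrixTrace τ k (X * B.map (incl N)) := by
    simp only [matrixTrace_mul, CStarMatrix.map_apply, hτ.restrict_expect_mul]
  rw [h]
  exact map_mul_nonneg (matrixTrace_nonneg hτ.nonneg) (matrixTrace_trace hτ.trace) hX hB'

/-- The conditional expectation as a completely positive map. -/
def IsTrace.expectCP : Elem M →CP Elem N.1 where
  toLinearMap := hτ.expect N
  map_cstarMatrix_nonneg' := hτ.expect_map_nonneg N

theorem IsTrace.isCondExp : IsCondExp τ N ((incl N).toLinearMap ∘ₗ hτ.expect N) where
  mem x := ⟨hτ.expect N x, rfl⟩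
  map_incl b := congrArg (incl N) (hτ.expect_incl N b)
  map_mul_mul b x c := by
    change incl N (hτ.expect N _) = incl N b * incl N (hτ.expect N x) * incl N c
    rw [hτ.expect_mul_mul, map_mul, map_mul]
  nonneg x hx := map_nonneg (incl N) (map_nonneg (hτ.expectCP N) hx)
  trace_eq x := hτ.restrict_expect N x

theorem IsTrace.condExp_apply (x : Elem M) : condExp τ N x = incl N (hτ.expect N x) := by
  have h : ∃ E, IsCondExp τ N E := ⟨_, hτ.isCondExp N⟩
  have h' : condExp τ N = (incl N).toLinearMap ∘ₗ hτ.expect N := by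
    rw [condExp, dif_pos h]
    exact h.choose_spec.unique hτ (hτ.isCondExp N)
  rw [h']
  rfl

theorem IsTrace.sub_expect_mul_incl (x : Elem M) (n : Elem N.1) :
    τ ((x - incl N (hτ.expect N x)) * incl N n) = 0 := by
  rw [sub_mul, map_sub, hτ.map_incl_expect_mul, sub_self]

theorem IsTrace.star_sub_expect_mul_incl (x : Elem M) (n : Elem N.1) :
    τ (star (x - incl N (hτ.expect N x)) * incl N n) = 0 := by
  have h := hτ.sub_expect_mul_incl N (star x) n
  rwa [hτ.expect_star, map_star, ← star_sub] at h

/-- Pythagoras: `x - E_N(x)` is orthogonal to `N`. -/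
theorem IsTrace.twoNorm_sq_sub_incl (x : Elem M) (n : Elem N.1) :
    twoNorm τ (x - incl N n) ^ 2 = twoNorm τ (x - incl N (hτ.expect N x)) ^ 2 +
      twoNorm (restrict τ N) (hτ.expect N x - n) ^ 2 := by
  set w := x - incl N (hτ.expect N x) with hw
  set m := hτ.expect N x - n with hm
  have hx : x - incl N n = w + incl N m := by rw [hw, hm, map_sub]; abel
  have h1 : τ (star w * incl N m) = 0 := hτ.star_sub_expect_mul_incl N x m
  have h2 : τ (star (incl N m) * w) = 0 := by
    rw [← map_star, hτ.trace]
    exact hτ.sub_expect_mul_incl N x _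
  rw [← twoNorm_incl, hτ.twoNorm_sq, hτ.twoNorm_sq, hτ.twoNorm_sq, hx, star_add, add_mul, mul_add,
    mul_add, map_add, map_add, map_add, h1, h2]
  simp

theorem IsTrace.twoNorm_sub_expect_le (x : Elem M) (n : Elem N.1) :
    twoNorm τ (x - incl N (hτ.expect N x)) ≤ twoNorm τ (x - incl N n) := by
  refine (sq_le_sq₀ (twoNorm_nonneg _) (twoNorm_nonneg _)).1 ?_
  rw [hτ.twoNorm_sq_sub_incl N x n]
  exact le_add_of_nonneg_right (sq_nonneg _)

theorem IsTrace.twoNorm_expect_le (x : Elem M) :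
    twoNorm (restrict τ N) (hτ.expect N x) ≤ twoNorm τ x := by
  refine (sq_le_sq₀ (twoNorm_nonneg _) (twoNorm_nonneg _)).1 ?_
  have h := hτ.twoNorm_sq_sub_incl N x 0
  rw [map_zero, sub_zero, sub_zero] at h
  rw [h]
  exact le_add_of_nonneg_left (sq_nonneg _)

end Expect

/-! ### Property (T) and the uniform distance -/

/-- The completely positive map `E_A E_B` restricted to `A`. -/
def IsTrace.bridge (hτ : IsTrace M τ) (A B : Subalgebras M) : Elem A.1 →CP Elem A.1 where
  toLinearMap := hτ.expect A ∘ₗ (incl B).toLinearMap ∘ₗ hτ.expect B ∘ₗ (incl A).toLinearMap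
  map_cstarMatrix_nonneg' k X hX :=
    hτ.expect_map_nonneg A k _ <|
      CompletelyPositiveMapClass.map_cstarMatrix_nonneg' (incl B) k _ <|
        hτ.expect_map_nonneg B k _ <|
          CompletelyPositiveMapClass.map_cstarMatrix_nonneg' (incl A) k X hX

theorem IsTrace.bridge_apply (hτ : IsTrace M τ) (A B : Subalgebras M) (x : Elem A.1) :
    hτ.bridge A B x = hτ.expect A (incl B (hτ.expect B (incl A x))) := rfl

theorem IsTrace.expect_one (hτ : IsTrace M τ) (N : Subalgebras M) : hτ.expect N 1 = 1 := by
  simpa using hτ.expect_incl N 1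

theorem IsTrace.bridge_one (hτ : IsTrace M τ) (A B : Subalgebras M) : hτ.bridge A B 1 = 1 := by
  simp [hτ.bridge_apply, hτ.expect_one]

theorem IsTrace.restrict_bridge (hτ : IsTrace M τ) (A B : Subalgebras M) (x : Elem A.1) :
    restrict τ A (hτ.bridge A B x) = restrict τ A x := by
  rw [hτ.bridge_apply, hτ.restrict_expect]
  exact hτ.restrict_expect B (incl A x)

theorem IsTrace.twoNorm_bridge_sub_le (hτ : IsTrace M τ) (A B : Subalgebras M) (x : Elem A.1)
    (y : Elem B.1) :
    twoNorm (restrict τ A) (hτ.bridge A B x - x) ≤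
      twoNorm τ (incl A x - incl B y) := by
  have h : hτ.bridge A B x - x =
      hτ.expect A (incl B (hτ.expect B (incl A x)) - incl A x) := by
    rw [map_sub, hτ.expect_incl, hτ.bridge_apply]
  rw [h]
  refine (hτ.twoNorm_expect_le A _).trans ?_
  rw [twoNorm_sub_comm]
  exact hτ.twoNorm_sub_expect_le B (incl A x) y

/-- If `E_A E_B` almost fixes `b ∈ A`, then `b` is almost in `B`, because
`‖b - E_B(b)‖₂² = τ(b⋆(b - E_B(b))) = τ(b⋆(b - E_A E_B(b)))`. -/
theorem IsTrace.twoNorm_sub_expect_sq_le (hτ : IsTrace M τ) (A B : Subalgebras M) {b : Elem A.1}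
    (hb : ‖b‖ ≤ 1) :
    twoNorm τ (incl A b - incl B (hτ.expect B (incl A b))) ^ 2 ≤
      twoNorm (restrict τ A) (hτ.bridge A B b - b) := by
  have ht := hτ.subalgebra A
  set w := incl A b - incl B (hτ.expect B (incl A b)) with hw
  have h1 : τ (star w * w) = τ (w * incl A (star b)) := by
    have h2 : τ (w * star (incl B (hτ.expect B (incl A b)))) = 0 := by
      rw [← map_star]
      exact hτ.sub_expect_mul_incl B (incl A b) _
    rw [hτ.trace]
    conv_lhs => rw [hw, star_sub, ← hw, mul_sub, map_sub, h2, sub_zero, ← map_star]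
  have h3 : τ (w * incl A (star b)) =
      restrict τ A (star b * (b - hτ.bridge A B b)) := by
    rw [← hτ.restrict_expect_mul, ht.trace, hw, map_sub, hτ.expect_incl, hτ.bridge_apply]
  have hb2 : twoNorm (restrict τ A) b ≤ 1 := (ht.twoNorm_le_norm b).trans hb
  rw [hτ.twoNorm_sq, h1, h3]
  calc (restrict τ A (star b * (b - hτ.bridge A B b))).re
      ≤ ‖restrict τ A (star b * (b - hτ.bridge A B b))‖ := Complex.re_le_norm _
    _ ≤ twoNorm (restrict τ A) b *
        twoNorm (restrict τ A) (b - hτ.bridge A B b) := cauchy_schwarz ht.nonneg _ _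
    _ ≤ 1 * twoNorm (restrict τ A) (b - hτ.bridge A B b) := by
        gcongr
        exact twoNorm_nonneg _
    _ = twoNorm (restrict τ A) (hτ.bridge A B b - b) := by
        rw [one_mul, twoNorm_sub_comm]

/-- `(F, δ)` is a Kazhdan pair for `ε` in `(N, t)`: a unital trace-preserving completely positive
map that moves `F` by less than `δ` moves the unit ball by less than `ε`. -/
def IsKazhdanPair {N : VonNeumannAlgebra H} (t : Elem N →ₗ[ℂ] ℂ) (F : Finset (Elem N))
    (δ ε : ℝ) : Prop :=
  ∀ φ : Elem N →CP Elem N, φ 1 = 1 → (∀ x, t (φ x) = t x) →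
    (∀ x ∈ F, twoNorm t (φ x - x) < δ) → ∀ b : Elem N, ‖b‖ ≤ 1 → twoNorm t (φ b - b) < ε

/-- If `B` comes `δ`-close to a Kazhdan set of `A`, then `A` is uniformly almost contained in `B`:
the Kazhdan pair is applied to `E_A E_B`. -/
theorem IsTrace.inftyTwoNorm_le (hτ : IsTrace M τ) (A B : Subalgebras M) {F : Finset (Elem A.1)}
    {δ ε r : ℝ} (hr : 0 ≤ r) (hε : ε ≤ r ^ 2)
    (hF : IsKazhdanPair (restrict τ A) F δ ε)
    (hB : ∀ x ∈ F, ∃ y : Elem B.1, twoNorm τ (incl A x - incl B y) < δ) :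
    inftyTwoNorm τ ((LinearMap.id - condExp τ B) ∘ₗ condExp τ A) ≤ r := by
  have key := hF (hτ.bridge A B) (hτ.bridge_one A B) (hτ.restrict_bridge A B) fun x hx => by
    obtain ⟨y, hy⟩ := hB x hx
    exact (hτ.twoNorm_bridge_sub_le A B x y).trans_lt hy
  refine Real.sSup_le ?_ hr
  rintro _ ⟨x, hx, rfl⟩
  have hb : ‖hτ.expect A x‖ ≤ 1 := (hτ.norm_expect_le A x).trans hx
  change twoNorm τ (condExp τ A x - condExp τ B (condExp τ A x)) ≤ r
  rw [hτ.condExp_apply, hτ.condExp_apply]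
  refine (sq_le_sq₀ (twoNorm_nonneg _) hr).1 ?_
  exact ((hτ.twoNorm_sub_expect_sq_le A B hb).trans (key _ hb).le).trans hε

/-! ### Countably many approximate Kazhdan sets -/

/-- The finite set `T ⊆ M` is within `1 / (m + 1)` of the algebra `N` and approximates, to the same
precision, a Kazhdan set of `N` for the tolerance `1 / (k + 1)`. -/
def ApproximatesKazhdan (τ : Elem M →ₗ[ℂ] ℂ) (N : Subalgebras M) (T : Finset (Elem M))
    (m k : ℕ) : Prop :=
  (∀ s ∈ T, ∃ x : Elem N.1, twoNorm τ (s - incl N x) < 1 / (m + 1)) ∧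
    ∃ F : Finset (Elem N.1), IsKazhdanPair (restrict τ N) F (2 * (1 / (m + 1))) (1 / (k + 1)) ∧
      ∀ x ∈ F, ∃ s ∈ T, twoNorm τ (incl N x - s) < 1 / (m + 1)

theorem exists_approximatesKazhdan {S : Set (Elem M)}
    (hS : ∀ x, ∀ ε : ℝ, 0 < ε → ∃ s ∈ S, twoNorm τ (x - s) < ε) {N : Subalgebras M}
    (hN : N ∈ propertyTSubalgebras τ) (k : ℕ) :
    ∃ (T : Finset S) (m : ℕ), ApproximatesKazhdan τ N (T.map (Function.Embedding.subtype _)) m k := by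
  classical
  obtain ⟨F, δ, hδ, hF⟩ := hN (1 / (k + 1)) (by positivity)
  obtain ⟨m, hm⟩ := exists_nat_one_div_lt (half_pos hδ)
  choose s hs hsx using fun x : Elem M => hS x (1 / (m + 1)) (by positivity)
  refine ⟨F.image fun x => ⟨s (incl N x), hs _⟩, m, ?_, F, ?_, ?_⟩
  · simp only [Finset.mem_map, Finset.mem_image]
    rintro _ ⟨_, ⟨x, -, rfl⟩, rfl⟩
    exact ⟨x, twoNorm_sub_comm (τ := τ) (incl N x) _ ▸ hsx (incl N x)⟩
  · exact fun φ h1 h2 h3 => hF φ h1 h2 fun x hx => (h3 x hx).trans (by linarith)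
  · exact fun x hx => ⟨s (incl N x), Finset.mem_map.2
      ⟨_, Finset.mem_image_of_mem _ hx, rfl⟩, hsx _⟩

/-- Two algebras that share an approximating set are uniformly close; the hypotheses are symmetric
in `A` and `B`, so this bounds both terms of `unifDist`. -/
theorem ApproximatesKazhdan.inftyTwoNorm_le (hτ : IsTrace M τ) {A B : Subalgebras M}
    {T : Finset (Elem M)} {m k : ℕ} (hA : ApproximatesKazhdan τ A T m k)
    (hB : ApproximatesKazhdan τ B T m k) {r : ℝ} (hr : 0 ≤ r) (hk : 1 / ((k : ℝ) + 1) ≤ r ^ 2) :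
    inftyTwoNorm τ ((LinearMap.id - condExp τ B) ∘ₗ condExp τ A) ≤ r := by
  obtain ⟨-, F, hF, hFT⟩ := hA
  refine hτ.inftyTwoNorm_le A B hr hk hF fun x hx => ?_
  obtain ⟨s, hs, hxs⟩ := hFT x hx
  obtain ⟨y, hy⟩ := hB.1 s hs
  exact ⟨y, (hτ.twoNorm_sub_le _ s _).trans_lt (by linarith)⟩

/-- Countably many properties have a countable set of witnesses in `S` for all those that hold
somewhere on `S`. -/
theorem exists_countable_forall_exists {ι X : Type*} [Countable ι] (S : Set X)
    (P : ι → X → Prop) :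
    ∃ D ⊆ S, D.Countable ∧ ∀ x ∈ S, ∀ i, P i x → ∃ y ∈ D, P i y := by
  let J := {i // ∃ x ∈ S, P i x}
  choose f hfS hfP using fun j : J => j.2
  refine ⟨Set.range f, Set.range_subset_iff.2 hfS, Set.countable_range f, fun x hx i hi => ?_⟩
  exact ⟨f ⟨i, x, hx, hi⟩, Set.mem_range_self _, hfP ⟨i, x, hx, hi⟩⟩

end TracialVN

end

theorem mainTheorem10 {H : Type*} [NormedAddCommGroup H] [InnerProductSpace ℂ H] [CompleteSpace H]
    (M : VonNeumannAlgebra H) (τ : TracialVN.Elem M →ₗ[ℂ] ℂ) (hτ : TracialVN.IsTrace M τ)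
    (hsep : TracialVN.IsSeparableTracial τ) :
    ∃ D : Set (TracialVN.Subalgebras M), D ⊆ TracialVN.propertyTSubalgebras τ ∧ D.Countable ∧
      ∀ N ∈ TracialVN.propertyTSubalgebras τ, ∀ ε : ℝ, 0 < ε →
        ∃ B ∈ D, TracialVN.unifDist τ N B < ε := by
  obtain ⟨S, hSc, hS⟩ := hsep
  have := hSc.to_subtype
  obtain ⟨D, hDT, hDc, hD⟩ := TracialVN.exists_countable_forall_exists
    (ι := Finset S × ℕ × ℕ) (TracialVN.propertyTSubalgebras τ) fun i N =>
      TracialVN.ApproximatesKazhdan τ N (i.1.map (Function.Embedding.subtype _)) i.2.1 i.2.2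
  refine ⟨D, hDT, hDc, fun N hN ε hε => ?_⟩
  obtain ⟨k, hk⟩ := exists_nat_one_div_lt (pow_pos (half_pos hε) 2)
  obtain ⟨T, m, hT⟩ := TracialVN.exists_approximatesKazhdan hS hN k
  obtain ⟨B, hB, hBT⟩ := hD N hN (T, m, k) hT
  refine ⟨B, hB, lt_of_le_of_lt (max_le ?_ ?_) (half_lt_self hε)⟩
  · exact hT.inftyTwoNorm_le hτ hBT (half_pos hε).le hk.le
  · exact hBT.inftyTwoNorm_le hτ hT (half_pos hε).le hk.le
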